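/- Let $M$ be a smooth manifold, let $(E,\rho_E,[\cdot,\cdot]_E)$ be a Lie algebroid over $M$ of rank $2m+1$, and let $(F_E,\xi,\eta,g_E)$ be an almost contact Riemannian structure on $E$. That is, $F_E\in\Gamma(E\otimes E^*)$, $\xi\in\Gamma(E)$, $\eta\in\Gamma(E^*)$, and $g_E$ is a Riemannian metric on $E$, such that $$F_E^2=-I_E+\eta\otimes\xi,\qquad \eta(\xi)=1,\qquad g_E(F_E s_1,F_E s_2)=g_E(s_1,s_2)-\eta(s_1)\eta(s_2)$$ for all $s_1,s_2\in\Gamma(E)$. Put $\Omega_E(s_1,s_2)=g_E(s_1,F_E s_2)$, let $d_E\eta$ be the exterior derivative with the normalization $$2\,d_E\eta(s_1,s_2)=\rho_E(s_1)(\eta(s_2))-\rho_E(s_2)(\eta(s_1))-\eta([s_1,s_2]_E),$$ and let $$N_{F_E}(s_1,s_2)=[F_Es_1,F_Es_2]_E-F_E[F_Es_1,s_2]_E-F_E[s_1,F_Es_2]_E+F_E^2[s_1,s_2]_E .$$ The structure is called Sasakian if $d_E\eta=\Omega_E$ and $N_{F_E}+2\,d_E\eta\otimes\xi=0$. Theorem.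 Let $\nabla$ be the Levi-Civita connection of $g_E$ on the Lie algebroid, i.e. the linear $E$-connection on $E$ which is compatible with $g_E$ and satisfies $\nabla_{s_1}s_2-\nabla_{s_2}s_1=[s_1,s_2]_E$. Then $(F_E,\xi,\eta,g_E)$ is Sasakian if and only if $$(\nabla_{s_1}F_E)s_2=g_E(s_1,s_2)\,\xi-\eta(s_2)\,s_1\qquad\text{for all } s_1,s_2\in\Gamma(E),$$ where $(\nabla_{s_1}F_E)s_2=\nabla_{s_1}(F_Es_2)-F_E(\nabla_{s_1}s_2)$. -/

import Mathlib

open Bundle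
open scoped Manifold ContDiff

namespace AlgebroidGeometry

noncomputable section

variable (n : ℕ) {M : Type*} [TopologicalSpace M] [ChartedSpace (EuclideanSpace ℝ (Fin n)) M]
  [IsManifold (𝓡 n) ∞ M]
  (F : Type*) [NormedAddCommGroup F] [NormedSpace ℝ F]
  (E : M → Type*) [TopologicalSpace (TotalSpace F E)]
  [∀ x, TopologicalSpace (E x)] [∀ x, AddCommGroup (E x)] [∀ x, Module ℝ (E x)]
  [∀ x, IsTopologicalAddGroup (E x)] [∀ x, ContinuousSMul ℝ (E x)]
  [FiberBundle F E] [VectorBundle ℝ F E]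

/-- The space `Γ(E)` of smooth global sections of a vector bundle `E` (with model fiber `F`)
over an `n`-dimensional manifold. -/
abbrev Sec : Type _ := Cₛ^∞⟮𝓡 n; F, E⟯

/-- Smooth `1`-forms on `E`: smooth sections of the dual bundle of `E`. -/
abbrev OneForm : Type _ :=
  Cₛ^∞⟮𝓡 n; F →L[ℝ] ℝ, fun x => E x →L[ℝ] Bundle.Trivial M ℝ x⟯

/-- Smooth `(1,1)`-tensor sections of `E`: smooth sections of the bundle of endomorphisms. -/
abbrev EndSec : Type _ :=
  Cₛ^∞⟮𝓡 n; F →L[ℝ] F, fun x => E x →L[ℝ] E x⟯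

/-- Smooth vector bundle morphisms `E → TM` over the identity of `M`. -/
abbrev AnchorMap : Type _ :=
  Cₛ^∞⟮𝓡 n; F →L[ℝ] EuclideanSpace ℝ (Fin n), fun x => E x →L[ℝ] TangentSpace (𝓡 n) x⟯

variable {n F E}

/-- The product `f s` of a smooth function and a smooth section. -/
def fmul (f : C^∞⟮𝓡 n, M; ℝ⟯) (s : Sec n F E) : Sec n F E :=
  ⟨fun x => f x • s x, f.contMDiff.smul_section s.contMDiff⟩

/-- The smooth section `A(s)`, where `A` is a `(1,1)`-tensor section. -/
def applyEnd (A : EndSec n F E) (s : Sec n F E) : Sec n F E :=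
  ⟨fun x => A x (s x), A.contMDiff.clm_bundle_apply s.contMDiff⟩

/-- The derivative `ρ(s)(f) : M → ℝ` of a function `f` in the direction of the vector field
`ρ(s)`. -/
def anchorDeriv (ρ : AnchorMap n F E) (s : Sec n F E) (f : M → ℝ) : M → ℝ :=
  fun x => mvfderiv (𝓡 n) f x (ρ x (s x))

variable (n F E) in
/-- A Lie algebroid structure on the vector bundle `E`: an anchor and a real Lie bracket on the
sections which satisfies the Leibniz rule. -/
structure LieAlgebroid where
  /-- The anchor `ρ : E → TM`. -/
  anchor : AnchorMap n F E
  /-- The bracket `[s₁, s₂]`. -/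
  bracket : Sec n F E →ₗ[ℝ] Sec n F E →ₗ[ℝ] Sec n F E
  bracket_self : ∀ s, bracket s s = 0
  jacobi : ∀ s₁ s₂ s₃,
    bracket s₁ (bracket s₂ s₃) + bracket s₂ (bracket s₃ s₁) + bracket s₃ (bracket s₁ s₂) = 0
  leibniz : ∀ (s₁ s₂ : Sec n F E) (f : C^∞⟮𝓡 n, M; ℝ⟯) (x : M),
    bracket s₁ (fmul f s₂) x = f x • bracket s₁ s₂ x + anchorDeriv anchor s₁ f x • s₂ x

/-- The exterior derivative of a `1`-form of the Lie algebroid, with the normalization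
`2 dη(s₁, s₂) = ρ(s₁)(η(s₂)) - ρ(s₂)(η(s₁)) - η([s₁, s₂])`. -/
def LieAlgebroid.d (A : LieAlgebroid n F E) (η : OneForm n F E) (s₁ s₂ : Sec n F E) : M → ℝ :=
  fun x => (1 / 2 : ℝ) * (anchorDeriv A.anchor s₁ (fun y => η y (s₂ y)) x
    - anchorDeriv A.anchor s₂ (fun y => η y (s₁ y)) x - η x (A.bracket s₁ s₂ x))

/-- The Nijenhuis tensor `N_T(s₁, s₂) = [T s₁, T s₂] - T [T s₁, s₂] - T [s₁, T s₂] + T² [s₁, s₂]`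
of a `(1,1)`-tensor section `T`. -/
def LieAlgebroid.nijenhuis (A : LieAlgebroid n F E) (T : EndSec n F E) (s₁ s₂ : Sec n F E) : Sec n F E :=
  A.bracket (applyEnd T s₁) (applyEnd T s₂) - applyEnd T (A.bracket (applyEnd T s₁) s₂)
    - applyEnd T (A.bracket s₁ (applyEnd T s₂)) + applyEnd T (applyEnd T (A.bracket s₁ s₂))

variable (n F E) in
/-- An almost contact Riemannian structure `(φ, ξ, η, g)` on `E`: `φ² = -I + η ⊗ ξ`, `η(ξ) = 1`, and
`g` is a smooth Riemannian metric on `E` with `g(φ v, φ w) = g(v, w) - η(v) η(w)`. -/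
structure AlmostContactRiemannian where
  /-- The `(1,1)`-tensor section, denoted `F_E` on paper. -/
  φ : EndSec n F E
  /-- The Reeb section. -/
  ξ : Sec n F E
  /-- The `1`-form. -/
  η : OneForm n F E
  /-- The Riemannian metric. -/
  g : ContMDiffRiemannianMetric (𝓡 n) ∞ F E
  φ_sq : ∀ (x : M) (v : E x), φ x (φ x v) = -v + (η x v : ℝ) • ξ x
  η_ξ : ∀ x : M, η x (ξ x) = (1 : ℝ)
  compatible : ∀ (x : M) (v w : E x),
    g.inner x (φ x v) (φ x w) = g.inner x v w - (η x v : ℝ) * (η x w : ℝ)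

/-- The fundamental `2`-form `Ω(s₁, s₂) = g(s₁, φ s₂)`. -/
def AlmostContactRiemannian.Ω (S : AlmostContactRiemannian n F E) (s₁ s₂ : Sec n F E) : M → ℝ :=
  fun x => S.g.inner x (s₁ x) (S.φ x (s₂ x))

/-- The structure is normal with respect to the Lie algebroid structure `A`:
`N_φ + 2 dη ⊗ ξ = 0`. -/
def AlmostContactRiemannian.IsNormal (S : AlmostContactRiemannian n F E) (A : LieAlgebroid n F E) :
    Prop :=
  ∀ (s₁ s₂ : Sec n F E) (x : M),
    A.nijenhuis S.φ s₁ s₂ x + (2 * A.d S.η s₁ s₂ x) • S.ξ x = 0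

/-- The structure is Sasakian with respect to the Lie algebroid structure `A`: `dη = Ω`, and it is
normal. -/
def AlmostContactRiemannian.IsSasakian (S : AlmostContactRiemannian n F E) (A : LieAlgebroid n F E) :
    Prop :=
  (∀ s₁ s₂ : Sec n F E, A.d S.η s₁ s₂ = S.Ω s₁ s₂) ∧ S.IsNormal A

/-- A linear connection on the Lie algebroid `A`, that is, an `A`-connection on the vector
bundle `E`; `conn s₁ s₂` is `∇_{s₁} s₂`. -/
structure LinearConnection (A : LieAlgebroid n F E) where
  /-- The covariant derivative `∇_{s₁} s₂`. -/
  conn : Sec n F E →ₗ[ℝ] Sec n F E →ₗ[ℝ] Sec n F E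
  conn_fmul_left : ∀ (f : C^∞⟮𝓡 n, M; ℝ⟯) (s₁ s₂ : Sec n F E),
    conn (fmul f s₁) s₂ = fmul f (conn s₁ s₂)
  leibniz : ∀ (s₁ s₂ : Sec n F E) (f : C^∞⟮𝓡 n, M; ℝ⟯) (x : M),
    conn s₁ (fmul f s₂) x = f x • conn s₁ s₂ x + anchorDeriv A.anchor s₁ f x • s₂ x

/-- `∇` is the Levi-Civita connection of the metric `g`: the (unique) linear connection on the
Lie algebroid that is torsion-free and compatible with `g`. -/
structure LinearConnection.IsLeviCivita {A : LieAlgebroid n F E} (D : LinearConnection A)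
    (g : ContMDiffRiemannianMetric (𝓡 n) ∞ F E) : Prop where
  torsion_free : ∀ s₁ s₂ : Sec n F E, D.conn s₁ s₂ - D.conn s₂ s₁ = A.bracket s₁ s₂
  metric : ∀ (s₁ s₂ s₃ : Sec n F E) (x : M),
    anchorDeriv A.anchor s₁ (fun y => g.inner y (s₂ y) (s₃ y)) x
      = g.inner x (D.conn s₁ s₂ x) (s₃ x) + g.inner x (s₂ x) (D.conn s₁ s₃ x)

/-- The covariant derivative of a `(1,1)`-tensor section:
`(∇_{s₁} T) s₂ = ∇_{s₁} (T s₂) - T (∇_{s₁} s₂)`. -/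
def LinearConnection.covEnd {A : LieAlgebroid n F E} (D : LinearConnection A) (T : EndSec n F E)
    (s₁ s₂ : Sec n F E) : Sec n F E :=
  D.conn s₁ (applyEnd T s₂) - applyEnd T (D.conn s₁ s₂)

end

end AlgebroidGeometry

set_option linter.unusedSectionVars false

namespace AlgebroidGeometry

noncomputable section

variable {n : ℕ} {M : Type*} [TopologicalSpace M] [ChartedSpace (EuclideanSpace ℝ (Fin n)) M]
  [IsManifold (𝓡 n) ∞ M]
  {F : Type*} [NormedAddCommGroup F] [NormedSpace ℝ F]
  {E : M → Type*} [TopologicalSpace (TotalSpace F E)]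
  [∀ x, TopologicalSpace (E x)] [∀ x, AddCommGroup (E x)] [∀ x, Module ℝ (E x)]
  [∀ x, IsTopologicalAddGroup (E x)] [∀ x, ContinuousSMul ℝ (E x)]
  [FiberBundle F E] [VectorBundle ℝ F E]

/-! ### Smooth functions, sections and anchor derivatives. -/

section Sections

/-! Everything reduces to the bilinear form `a(s,t) = g(∇_s ξ, t)` and the trilinear form `g((∇_s
φ)t, u)`.

Given a Sasakian structure, `dη = Ω` says that `a - aᵀ = 2Ω` and, since `d² = 0`, that the cyclic
sum of `g((∇φ)·,·)` vanishes (`cyclic_covEnd`). With normality at `ξ` this makes `a` skew, so `a =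
Ω`, i.e. `∇ξ = -φ`. Let `Q` be the trilinear form minus its expected value. It is skew in its last
two slots, has zero cyclic sum, obeys the homogeneous normality equation and lets `φ` pass between
those slots: the symmetries of `∇J` on a Kähler manifold. Pure algebra
(`eq_zero_of_kaehler_symmetries`) kills `Q(·, φ·, ·)`, and the value at `ξ` follows from `∇ξ = -φ`.

Conversely, the formula at `s₂ = ξ` gives `∇ξ = -φ`, and both Sasakian conditions follow by
substitution. -/

@[simp] lemma fmul_apply (f : C^∞⟮𝓡 n, M; ℝ⟯) (s : Sec n F E) (x : M) :
    fmul f s x = f x • s x := rfl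

@[simp] lemma applyEnd_apply (T : EndSec n F E) (s : Sec n F E) (x : M) :
    applyEnd T s x = T x (s x) := rfl

/-- The smooth function `g(s, t)`. -/
def metricFun (g : ContMDiffRiemannianMetric (𝓡 n) ∞ F E) (s t : Sec n F E) :
    C^∞⟮𝓡 n, M; ℝ⟯ :=
  ⟨fun x => g.inner x (s x) (t x), by
    have h : ContMDiff (𝓡 n) ((𝓡 n).prod 𝓘(ℝ)) ∞
        (fun x => TotalSpace.mk' ℝ (E := Bundle.Trivial M ℝ) x (g.inner x (s x) (t x))) := fun x =>
      ContMDiffAt.clm_bundle_apply₂ (F₁ := F) (F₂ := F) (g.contMDiff x) (s.contMDiff x)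
        (t.contMDiff x)
    exact fun x => (contMDiffAt_section x).1 (h x)⟩

@[simp] lemma metricFun_apply (g : ContMDiffRiemannianMetric (𝓡 n) ∞ F E) (s t : Sec n F E)
    (x : M) : metricFun g s t x = g.inner x (s x) (t x) := rfl

lemma anchorDeriv_sub (ρ : AnchorMap n F E) (s : Sec n F E) (f h : C^∞⟮𝓡 n, M; ℝ⟯) (x : M) :
    anchorDeriv ρ s (fun y => f y - h y) x = anchorDeriv ρ s f x - anchorDeriv ρ s h x := by
  have hf : MDifferentiableAt (𝓡 n) 𝓘(ℝ) f x := f.contMDiff.mdifferentiableAt (by simp)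
  have hh : MDifferentiableAt (𝓡 n) 𝓘(ℝ) h x := h.contMDiff.mdifferentiableAt (by simp)
  have := mvfderiv_sub hf hh
  simp only [anchorDeriv]
  exact congrArg (fun L => L (ρ x (s x))) this

lemma anchorDeriv_neg (ρ : AnchorMap n F E) (s : Sec n F E) (f : M → ℝ) (x : M) :
    anchorDeriv ρ s (fun y => -f y) x = -anchorDeriv ρ s f x := by
  have := mvfderiv_neg (I := 𝓡 n) (g := f) (x := x)
  simp only [anchorDeriv]
  exact congrArg (fun L => L (ρ x (s x))) this

lemma anchorDeriv_const (ρ : AnchorMap n F E) (s : Sec n F E) (c : ℝ) (x : M) :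
    anchorDeriv ρ s (fun _ => c) x = 0 := by
  simp [anchorDeriv, mvfderiv_const]

end Sections

/-! ### Consequences of Jacobi and Leibniz. -/

section LieAlgebroid

variable (A : LieAlgebroid n F E)

lemma LieAlgebroid.bracket_antisymm (s t : Sec n F E) : A.bracket s t = -A.bracket t s := by
  have h := A.bracket_self (s + t)
  simp only [map_add, LinearMap.add_apply, A.bracket_self, zero_add, add_zero] at h
  exact eq_neg_of_add_eq_zero_right h

lemma LieAlgebroid.bracket_fmul (s t : Sec n F E) (f h : C^∞⟮𝓡 n, M; ℝ⟯)
    (hh : ∀ x, anchorDeriv A.anchor s f x = h x) :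
    A.bracket s (fmul f t) = fmul f (A.bracket s t) + fmul h t := by
  ext x
  simp [A.leibniz, hh]

lemma LieAlgebroid.bracket_bracket (s t u : Sec n F E) :
    A.bracket (A.bracket s t) u = A.bracket s (A.bracket t u) - A.bracket t (A.bracket s u) := by
  have h := A.jacobi s t u
  rw [A.bracket_antisymm u s, A.bracket_antisymm u (A.bracket s t), map_neg] at h
  rw [← sub_eq_zero, ← neg_eq_zero, ← h]
  abel

/-- The anchor is compatible with the brackets on a function `f` whose derivatives along the
given sections are smooth, as soon as there is a section which does not vanish. -/
lemma LieAlgebroid.anchorDeriv_bracket (s t u : Sec n F E) (f fs ft : C^∞⟮𝓡 n, M; ℝ⟯)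
    (hs : ∀ x, anchorDeriv A.anchor s f x = fs x) (ht : ∀ x, anchorDeriv A.anchor t f x = ft x)
    (x : M) (hu : u x ≠ 0) :
    anchorDeriv A.anchor (A.bracket s t) f x
      = anchorDeriv A.anchor s ft x - anchorDeriv A.anchor t fs x := by
  have h := congrArg (fun σ : Sec n F E => σ x) (A.bracket_bracket s t (fmul f u))
  have h' := congrArg (fun σ : Sec n F E => σ x) (A.bracket_bracket s t u)
  -- Expanding Jacobi on `f u` by Leibniz, the mixed first-order terms cancel and only the
  -- coefficient of `u` survives.
  rw [A.bracket_fmul t u f ft ht, A.bracket_fmul s u f fs hs] at h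
  simp only [map_add, ContMDiffSection.coe_add, ContMDiffSection.coe_sub, Pi.add_apply,
    Pi.sub_apply, A.leibniz, hs, ht] at h h'
  rw [h'] at h
  refine smul_left_injective ℝ hu ?_
  simp only
  rw [← sub_eq_zero] at h ⊢
  rw [← h]
  module

end LieAlgebroid

/-! ### Pointwise algebra of the almost contact structure. -/

section AlmostContact

variable (S : AlmostContactRiemannian n F E) (x : M)

namespace AlmostContactRiemannian

lemma inner_self_eq_zero {v : E x} (h : S.g.inner x v v = 0) : v = 0 := by
  by_contra hv
  exact (S.g.pos x v hv).ne' h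

lemma ξ_ne_zero : S.ξ x ≠ 0 := by
  intro h
  have := S.η_ξ x
  rw [h, map_zero] at this
  exact zero_ne_one this

/-- Since `φ²ξ = 0`, the formula for `φ²` at `φξ` gives `φξ = cξ`; applying `φ` again gives `c² =
0`. -/
lemma φ_ξ : S.φ x (S.ξ x) = 0 := by
  have h1 : S.φ x (S.φ x (S.ξ x)) = 0 := by
    rw [S.φ_sq, S.η_ξ, one_smul, neg_add_cancel]
  have h2 := S.φ_sq x (S.φ x (S.ξ x))
  rw [h1, map_zero] at h2
  have h3 : S.φ x (S.ξ x) = (S.η x (S.φ x (S.ξ x)) : ℝ) • S.ξ x := by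
    rw [← sub_eq_zero, ← neg_eq_zero, neg_sub, sub_eq_neg_add]; exact h2.symm
  set c : ℝ := S.η x (S.φ x (S.ξ x))
  rw [h3, map_smul, h3, smul_smul, smul_eq_zero] at h1
  rw [h3]
  rcases h1 with h | h
  · rw [mul_self_eq_zero.1 h, zero_smul]
  · exact absurd h (S.ξ_ne_zero x)

lemma η_eq (v : E x) : (S.η x v : ℝ) = S.g.inner x v (S.ξ x) := by
  have h := S.compatible x v (S.ξ x)
  rw [S.φ_ξ, map_zero, S.η_ξ, mul_one] at h
  exact (sub_eq_zero.1 h.symm).symm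

lemma η_φ (v : E x) : (S.η x (S.φ x v) : ℝ) = 0 := by
  have h := S.φ_sq x (S.φ x v)
  rw [S.φ_sq x v, map_add, map_neg, map_smul, S.φ_ξ, smul_zero, add_zero] at h
  have h' : (S.η x (S.φ x v) : ℝ) • S.ξ x = 0 := by simpa using h
  exact (smul_eq_zero.1 h').resolve_right (S.ξ_ne_zero x)

lemma inner_ξ_ξ : S.g.inner x (S.ξ x) (S.ξ x) = 1 := by
  rw [← S.η_eq, S.η_ξ]

lemma inner_φ_ξ (v : E x) : S.g.inner x (S.φ x v) (S.ξ x) = 0 := by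
  rw [← S.η_eq, S.η_φ]

lemma φ_sq' (v : E x) : S.φ x (S.φ x v) = -v + S.g.inner x v (S.ξ x) • S.ξ x := by
  rw [S.φ_sq, S.η_eq]

lemma inner_φ (v w : E x) : S.g.inner x (S.φ x v) w = -S.g.inner x v (S.φ x w) := by
  have h := S.compatible x (S.φ x v) w
  rw [S.η_φ, zero_mul, sub_zero, S.φ_sq', map_add, map_neg, map_smul] at h
  simp only [_root_.add_apply, _root_.neg_apply,
    _root_.smul_apply, smul_eq_mul] at h
  rw [S.g.symm x (S.ξ x), S.inner_φ_ξ, mul_zero, add_zero] at h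
  exact h.symm

lemma applyEnd_applyEnd (s : Sec n F E) :
    applyEnd S.φ (applyEnd S.φ s) = -s + fmul (metricFun S.g s S.ξ) S.ξ := by
  ext x
  simp [S.φ_sq']

lemma applyEnd_ξ : applyEnd S.φ S.ξ = 0 := by
  ext x
  simp [S.φ_ξ]

end AlmostContactRiemannian

end AlmostContact

/-! ### Identities for `∇φ` and `∇ξ`. -/

section LeviCivita

/-- A function of three arguments which satisfies the symmetries of `∇φ` for a Kähler-type
structure vanishes as soon as its middle argument is in the image of `φ`. -/
lemma eq_zero_of_kaehler_symmetries {L : Type*} (φ : L → L) (Q : L → L → L → ℝ)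
    (skew : ∀ X Y Z, Q X Y Z = -Q X Z Y)
    (cyclic : ∀ X Y Z, Q X Y Z + Q Y Z X + Q Z X Y = 0)
    (normal : ∀ X Y Z, Q (φ X) Y Z - Q (φ Y) X Z + Q X Y (φ Z) - Q Y X (φ Z) = 0)
    (move : ∀ X Y Z, Q X (φ Y) Z = Q X Y (φ Z)) (X Y Z : L) : Q X (φ Y) Z = 0 := by
  -- The sum `Q (φ A) B C + Q A (φ B) C` is skew in `B, C` and symmetric in `A, B`, hence zero.
  have anti : ∀ X Y Z, Q (φ X) Y Z = -Q X (φ Y) Z := by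
    intro X Y Z
    have s1 : ∀ A B C, Q (φ A) B C + Q A (φ B) C = -(Q (φ A) C B + Q A (φ C) B) := by
      intro A B C
      linarith [skew (φ A) B C, skew A (φ B) C, move A C B, skew A B (φ C), move A B C,
        skew A (φ C) B]
    have s2 : ∀ A B C, Q (φ A) B C + Q A (φ B) C = Q (φ B) A C + Q B (φ A) C := by
      intro A B C
      linarith [normal A B C, move A B C, move B A C]
    linarith [s1 X Y Z, s2 X Z Y, s1 Z X Y, s2 Z Y X, s1 Y Z X, s2 Y X Z]
  have key : ∀ X Y Z, Q X (φ Y) Z = Q Y (φ Z) X + Q Z (φ X) Y := by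
    intro X Y Z
    linarith [cyclic (φ X) Y Z, anti X Y Z, move Y Z X]
  -- Three cyclic shifts, each the sum of the other two, all vanish.
  linarith [key X Y Z, key Y Z X, key Z X Y]

variable {A : LieAlgebroid n F E} (S : AlmostContactRiemannian n F E)
  {D : LinearConnection A}

lemma LinearConnection.covEnd_apply (T : EndSec n F E) (s t : Sec n F E) (x : M) :
    D.covEnd T s t x = D.conn s (applyEnd T t) x - T x (D.conn s t x) := rfl

lemma LinearConnection.covEnd_ξ (s : Sec n F E) (x : M) :
    D.covEnd S.φ s S.ξ x = -S.φ x (D.conn s S.ξ x) := by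
  rw [D.covEnd_apply, S.applyEnd_ξ, map_zero]
  simp

variable (hD : D.IsLeviCivita S.g)
include hD

lemma LinearConnection.IsLeviCivita.bracket_apply (s t : Sec n F E) (x : M) :
    A.bracket s t x = D.conn s t x - D.conn t s x := by
  rw [← hD.torsion_free]; rfl

lemma LinearConnection.IsLeviCivita.inner_covEnd_antisymm (s t u : Sec n F E) (x : M) :
    S.g.inner x (D.covEnd S.φ s t x) (u x) = -S.g.inner x (D.covEnd S.φ s u x) (t x) := by
  have h1 := hD.metric s (applyEnd S.φ t) u x
  have h2 := hD.metric s t (applyEnd S.φ u) x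
  have h3 : (fun y => S.g.inner y (applyEnd S.φ t y) (u y))
      = fun y => -S.g.inner y (t y) (applyEnd S.φ u y) := by
    ext y
    exact S.inner_φ y _ _
  rw [h3, anchorDeriv_neg, h2] at h1
  simp only [D.covEnd_apply, map_sub, _root_.sub_apply]
  simp only [applyEnd_apply, S.inner_φ] at h1 ⊢
  rw [S.g.symm x _ (t x), S.g.symm x (D.conn s u x)]
  have h4 := S.inner_φ x (t x) (D.conn s u x)
  linarith

lemma LinearConnection.IsLeviCivita.inner_conn_ξ_ξ (s : Sec n F E) (x : M) :
    S.g.inner x (D.conn s S.ξ x) (S.ξ x) = 0 := by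
  have h := hD.metric s S.ξ S.ξ x
  simp only [S.inner_ξ_ξ, anchorDeriv_const] at h
  rw [S.g.symm x (S.ξ x)] at h
  linarith

lemma LinearConnection.IsLeviCivita.anchorDeriv_η (s t : Sec n F E) (x : M) :
    anchorDeriv A.anchor s (metricFun S.g t S.ξ) x
      = (metricFun S.g (D.conn s t) S.ξ + metricFun S.g t (D.conn s S.ξ)) x :=
  hD.metric s t S.ξ x

lemma LinearConnection.IsLeviCivita.d_η (s t : Sec n F E) (x : M) :
    A.d S.η s t x
      = (1 / 2) * (S.g.inner x (D.conn s S.ξ x) (t x) - S.g.inner x (D.conn t S.ξ x) (s x)) := by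
  have h1 := hD.anchorDeriv_η S s t x
  have h2 := hD.anchorDeriv_η S t s x
  simp only [LieAlgebroid.d, S.η_eq]
  change (1 / 2) * (anchorDeriv A.anchor s (metricFun S.g t S.ξ) x
    - anchorDeriv A.anchor t (metricFun S.g s S.ξ) x - _) = _
  rw [h1, h2, hD.bracket_apply S]
  simp only [ContMDiffMap.coe_add, Pi.add_apply, metricFun_apply, map_sub, _root_.sub_apply]
  rw [S.g.symm x (t x), S.g.symm x (s x)]
  ring

/-- Obtained by differentiating `φ² = -I + η ⊗ ξ` along `s`. -/
lemma LinearConnection.IsLeviCivita.covEnd_φ (s t : Sec n F E) (x : M) :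
    D.covEnd S.φ s (applyEnd S.φ t) x + S.φ x (D.covEnd S.φ s t x)
      = S.g.inner x (D.conn s S.ξ x) (t x) • S.ξ x
        + S.g.inner x (t x) (S.ξ x) • D.conn s S.ξ x := by
  have h := hD.anchorDeriv_η S s t x
  simp only [D.covEnd_apply, S.applyEnd_applyEnd, map_add, map_neg, map_sub,
    ContMDiffSection.coe_add, ContMDiffSection.coe_neg, Pi.add_apply, Pi.neg_apply, D.leibniz, h,
    S.φ_sq', metricFun_apply, ContMDiffMap.coe_add]
  rw [S.g.symm x (t x) (D.conn s S.ξ x)]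
  module

lemma LinearConnection.IsLeviCivita.nijenhuis_apply (s t : Sec n F E) (x : M) :
    A.nijenhuis S.φ s t x
      = D.covEnd S.φ (applyEnd S.φ s) t x - D.covEnd S.φ (applyEnd S.φ t) s x
        - S.φ x (D.covEnd S.φ s t x) + S.φ x (D.covEnd S.φ t s x) := by
  simp only [LieAlgebroid.nijenhuis, D.covEnd_apply, ContMDiffSection.coe_add,
    ContMDiffSection.coe_sub, Pi.add_apply, Pi.sub_apply, applyEnd_apply, hD.bracket_apply S,
    map_sub]
  abel

/-- If `dη = Ω`, then `Ω` is closed, which is expressed here through the covariant derivative of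
`φ`. -/
lemma LinearConnection.IsLeviCivita.cyclic_covEnd
    (hΩ : ∀ s t : Sec n F E, A.d S.η s t = S.Ω s t) (s t u : Sec n F E) (x : M) :
    S.g.inner x (D.covEnd S.φ s t x) (u x) + S.g.inner x (D.covEnd S.φ t u x) (s x)
      + S.g.inner x (D.covEnd S.φ u s x) (t x) = 0 := by
  let f : Sec n F E → C^∞⟮𝓡 n, M; ℝ⟯ := fun a => metricFun S.g a S.ξ
  let f' : Sec n F E → Sec n F E → C^∞⟮𝓡 n, M; ℝ⟯ := fun a b =>
    metricFun S.g (D.conn a b) S.ξ + metricFun S.g b (D.conn a S.ξ)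
  let w : Sec n F E → Sec n F E → C^∞⟮𝓡 n, M; ℝ⟯ := fun a b => metricFun S.g a (applyEnd S.φ b)
  have w_skew : ∀ a b y, w a b y = -w b a y := by
    intro a b y
    have := S.inner_φ y (b y) (a y)
    rw [S.g.symm y] at this
    exact this
  have hf : ∀ a b y, anchorDeriv A.anchor a (f b) y = f' a b y := fun a b y =>
    hD.anchorDeriv_η S a b y
  have dη : ∀ a b y, 2 * w a b y = f' a b y - f' b a y - f (A.bracket a b) y := by
    intro a b y
    have h := congrFun (hΩ a b) y
    simp only [LieAlgebroid.d, S.η_eq] at h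
    change (1 / 2) * (anchorDeriv A.anchor a (f b) y - anchorDeriv A.anchor b (f a) y
      - f (A.bracket a b) y) = w a b y at h
    rw [hf, hf] at h
    linarith
  -- By skewness `w b c - w c b` is `2 w b c`, so this is `2dη = ...` differentiated along `a`.
  have dw : ∀ a b c, anchorDeriv A.anchor a (w b c) x - anchorDeriv A.anchor a (w c b) x
      = anchorDeriv A.anchor a (f' b c) x - anchorDeriv A.anchor a (f' c b) x
        - f' a (A.bracket b c) x := by
    intro a b c
    rw [← hf, ← anchorDeriv_sub, ← anchorDeriv_sub]
    refine Eq.trans ?_ (anchorDeriv_sub _ _ (f' b c - f' c b) _ _)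
    congr 1
    ext y
    have := dη b c y
    simp only [ContMDiffMap.coe_sub, Pi.sub_apply]
    linarith [w_skew b c y]
  have hbr : ∀ a b c, 2 * w (A.bracket a b) c x
      = anchorDeriv A.anchor a (f' b c) x - anchorDeriv A.anchor b (f' a c) x
        - f' c (A.bracket a b) x - f (A.bracket (A.bracket a b) c) x := by
    intro a b c
    rw [dη, ← hf (A.bracket a b), A.anchorDeriv_bracket a b S.ξ (f c) (f' a c) (f' b c) (hf a c)
      (hf b c) x (S.ξ_ne_zero x)]
  have hjac : f (A.bracket (A.bracket s t) u) x + f (A.bracket (A.bracket t u) s) x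
      + f (A.bracket (A.bracket u s) t) x = 0 := by
    have h := congrArg (fun σ : Sec n F E => S.g.inner x (σ x) (S.ξ x)) (A.jacobi s t u)
    rw [A.bracket_antisymm s (A.bracket t u), A.bracket_antisymm t (A.bracket u s),
      A.bracket_antisymm u (A.bracket s t)] at h
    simp only [ContMDiffSection.coe_add, ContMDiffSection.coe_neg, ContMDiffSection.coe_zero,
      Pi.add_apply, Pi.neg_apply, Pi.zero_apply, map_add, map_neg, map_zero, _root_.add_apply,
      _root_.neg_apply, _root_.zero_apply] at h
    simp only [f, metricFun_apply]
    linarith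
  have hmet : ∀ a b c, anchorDeriv A.anchor a (w b c) x
      = w (D.conn a b) c x + S.g.inner x (D.covEnd S.φ a c x) (b x) + w b (D.conn a c) x := by
    intro a b c
    have h := hD.metric a b (applyEnd S.φ c) x
    rw [show D.conn a (applyEnd S.φ c) x
      = D.covEnd S.φ a c x + S.φ x (D.conn a c x) by rw [D.covEnd_apply]; abel, map_add,
      S.g.symm x (b x) (D.covEnd S.φ a c x)] at h
    refine h.trans ?_
    simp only [w, metricFun_apply, applyEnd_apply]
    ring
  have hwb : ∀ a b c, w (A.bracket a b) c x = w (D.conn a b) c x - w (D.conn b a) c x := by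
    intro a b c
    simp only [w, metricFun_apply, hD.bracket_apply S, map_sub, _root_.sub_apply]
  have hneg : ∀ a b c, f' a (A.bracket b c) x = -f' a (A.bracket c b) x := by
    intro a b c
    rw [← hf, ← hf, A.bracket_antisymm b c, ← anchorDeriv_neg]
    congr 1
    ext y
    simp [f]
  -- Summed cyclically, the derivatives of `f'` cancel and Jacobi removes the double brackets: this
  -- is `d(dη) = 0`. Rewriting the rest through `∇` leaves only the `∇φ` terms.
  linarith [dw s t u, dw t u s, dw u s t, hbr s t u, hbr t u s, hbr u s t,
    hmet s t u, hmet t u s, hmet u s t, hmet s u t, hmet t s u, hmet u t s,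
    hwb s t u, hwb t u s, hwb u s t, hneg s t u, hneg t u s, hneg u s t,
    w_skew (D.conn s t) u x, w_skew (D.conn t u) s x, w_skew (D.conn u s) t x,
    w_skew (D.conn s u) t x, w_skew (D.conn t s) u x, w_skew (D.conn u t) s x,
    hD.inner_covEnd_antisymm S s t u x, hD.inner_covEnd_antisymm S t u s x,
    hD.inner_covEnd_antisymm S u s t x]

end LeviCivita


/-! ### The two implications. -/

section Sasakian

variable {A : LieAlgebroid n F E} {S : AlmostContactRiemannian n F E}
  {D : LinearConnection A} (hD : D.IsLeviCivita S.g)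
include hD

lemma AlmostContactRiemannian.IsNormal.inner_covEnd (hN : S.IsNormal A)
    (hΩ : ∀ s t : Sec n F E, A.d S.η s t = S.Ω s t) (s t u : Sec n F E) (x : M) :
    S.g.inner x (D.covEnd S.φ (applyEnd S.φ s) t x) (u x)
      - S.g.inner x (D.covEnd S.φ (applyEnd S.φ t) s x) (u x)
      + S.g.inner x (D.covEnd S.φ s t x) (S.φ x (u x))
      - S.g.inner x (D.covEnd S.φ t s x) (S.φ x (u x))
      = -2 * S.g.inner x (s x) (S.φ x (t x)) * S.g.inner x (u x) (S.ξ x) := by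
  have h := congrArg (fun v => S.g.inner x v (u x)) (hN s t x)
  simp only [hΩ, hD.nijenhuis_apply S, AlmostContactRiemannian.Ω, map_add, map_sub, map_smul,
    map_zero, _root_.add_apply, _root_.sub_apply, _root_.smul_apply, _root_.zero_apply,
    smul_eq_mul, S.inner_φ x (D.covEnd S.φ _ _ x)] at h
  rw [S.g.symm x (S.ξ x) (u x)] at h
  linarith

/-- On a Sasakian Lie algebroid `∇ξ = -φ`, in the weak form `g(∇_s ξ, t) = Ω(s, t)`. -/
lemma AlmostContactRiemannian.IsSasakian.inner_conn_ξ (hS : S.IsSasakian A)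
    (s t : Sec n F E) (x : M) :
    S.g.inner x (D.conn s S.ξ x) (t x) = S.g.inner x (s x) (S.φ x (t x)) := by
  let a : Sec n F E → Sec n F E → ℝ := fun s t => S.g.inner x (D.conn s S.ξ x) (t x)
  have a_sub : ∀ s t, a s t - a t s = 2 * S.g.inner x (s x) (S.φ x (t x)) := by
    intro s t
    have h := congrFun (hS.1 s t) x
    rw [hD.d_η S] at h
    simp only [AlmostContactRiemannian.Ω] at h
    simp only [a]
    linarith
  have a_ξ_right : ∀ s, a s S.ξ = 0 := fun s => hD.inner_conn_ξ_ξ S s x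
  have a_ξ_left : ∀ s, a S.ξ s = 0 := by
    intro s
    have h := a_sub S.ξ s
    rw [a_ξ_right, S.g.symm x (S.ξ x), S.inner_φ_ξ] at h
    linarith
  have a_φ_φ_left : ∀ s t, a (applyEnd S.φ (applyEnd S.φ s)) t = -a s t := by
    intro s t
    have h := a_ξ_left t
    simp only [a, S.applyEnd_applyEnd, map_add, map_neg, LinearMap.add_apply, LinearMap.neg_apply,
      D.conn_fmul_left, ContMDiffSection.coe_add, ContMDiffSection.coe_neg, Pi.add_apply,
      Pi.neg_apply, fmul_apply, map_smul, _root_.add_apply, _root_.neg_apply, _root_.smul_apply,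
      smul_eq_mul] at h ⊢
    rw [h]
    ring
  have a_φ_φ_right : ∀ s t, a s (applyEnd S.φ (applyEnd S.φ t)) = -a s t := by
    intro s t
    have h := a_ξ_right s
    simp only [a, applyEnd_apply, S.φ_sq', map_add, map_neg, map_smul, smul_eq_mul] at h ⊢
    rw [h]
    ring
  have cov_ξ : ∀ s t, S.g.inner x (D.covEnd S.φ s S.ξ x) (t x) = a s (applyEnd S.φ t) := by
    intro s t
    rw [D.covEnd_ξ, map_neg, _root_.neg_apply, S.inner_φ, neg_neg]
    rfl
  -- Normality at `(s, ξ)` involves `(∇_ξ φ)s`, which the cyclic identity on `ξ, s, φt` expresses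
  -- through `a`; the terms in `(∇_s φ)ξ` cancel.
  have skew_image : ∀ s t, a (applyEnd S.φ s) (applyEnd S.φ t)
      = -a (applyEnd S.φ t) (applyEnd S.φ s) := by
    intro s t
    have hn := hS.2.inner_covEnd hD hS.1 s S.ξ t x
    have h1 := cov_ξ (applyEnd S.φ s) t
    have h2 := cov_ξ s (applyEnd S.φ t)
    have h3 := hD.cyclic_covEnd S hS.1 S.ξ s (applyEnd S.φ t) x
    have h4 := hD.inner_covEnd_antisymm S s (applyEnd S.φ t) S.ξ x
    have h5 := cov_ξ (applyEnd S.φ t) s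
    have h0 : D.covEnd S.φ (applyEnd S.φ S.ξ) s x = 0 := by
      rw [S.applyEnd_ξ, D.covEnd_apply]
      simp
    rw [h0, S.φ_ξ] at hn
    simp only [map_zero, _root_.zero_apply, mul_zero, zero_mul] at hn
    rw [a_φ_φ_right] at h2
    simp only [applyEnd_apply] at *
    linarith
  -- As `a` ignores `ξ`-components, replacing both arguments by `φ²` does not change it, so skewness
  -- on the image of `φ` holds everywhere.
  have h := skew_image (applyEnd S.φ s) (applyEnd S.φ t)
  rw [a_φ_φ_left, a_φ_φ_left, a_φ_φ_right, a_φ_φ_right] at h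
  have h' := a_sub s t
  change a s t = _
  linarith

/-- The derivative of `φ` on a Sasakian Lie algebroid. -/
lemma AlmostContactRiemannian.IsSasakian.inner_covEnd (hS : S.IsSasakian A)
    (s t u : Sec n F E) (x : M) :
    S.g.inner x (D.covEnd S.φ s t x) (u x)
      = S.g.inner x (s x) (t x) * S.g.inner x (u x) (S.ξ x)
        - S.g.inner x (t x) (S.ξ x) * S.g.inner x (s x) (u x) := by
  let Q : Sec n F E → Sec n F E → Sec n F E → ℝ := fun s t u =>
    S.g.inner x (D.covEnd S.φ s t x) (u x)
      - (S.g.inner x (s x) (t x) * S.g.inner x (u x) (S.ξ x)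
        - S.g.inner x (t x) (S.ξ x) * S.g.inner x (s x) (u x))
  have move : ∀ s t u, Q s (applyEnd S.φ t) u = Q s t (applyEnd S.φ u) := by
    intro s t u
    have h := congrArg (fun v => S.g.inner x v (u x)) (hD.covEnd_φ S s t x)
    simp only [map_add, map_smul, _root_.add_apply, _root_.smul_apply, smul_eq_mul, S.inner_φ x
      (D.covEnd S.φ _ _ x), hS.inner_conn_ξ hD] at h
    simp only [Q, applyEnd_apply, S.inner_φ_ξ]
    rw [S.g.symm x (S.ξ x) (u x)] at h
    linarith
  have hQ : ∀ s t u, Q s (applyEnd S.φ t) u = 0 := by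
    refine eq_zero_of_kaehler_symmetries (applyEnd S.φ) Q ?_ ?_ ?_ move
    · intro s t u
      have h := hD.inner_covEnd_antisymm S s t u x
      simp only [Q]
      linarith
    · intro s t u
      have h := hD.cyclic_covEnd S hS.1 s t u x
      simp only [Q]
      rw [S.g.symm x (t x) (s x), S.g.symm x (u x) (s x), S.g.symm x (u x) (t x)]
      linarith
    · intro s t u
      have h := hS.2.inner_covEnd hD hS.1 s t u x
      simp only [Q, applyEnd_apply, S.inner_φ_ξ, S.inner_φ]
      rw [S.g.symm x (t x) (S.φ x (s x)), S.inner_φ, S.g.symm x (t x) (s x)]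
      linear_combination h
  -- Since `φ²t = -t + η(t)ξ`, this reduces `Q s t u` to `η(t)` times `Q s ξ u`, which `h2` shows to
  -- be zero.
  have h1 := hQ s (applyEnd S.φ t) u
  rw [S.applyEnd_applyEnd] at h1
  have h2 : S.g.inner x (D.covEnd S.φ s S.ξ x) (u x)
      = S.g.inner x (s x) (S.ξ x) * S.g.inner x (u x) (S.ξ x) - S.g.inner x (s x) (u x) := by
    rw [D.covEnd_ξ, map_neg, _root_.neg_apply, S.inner_φ, neg_neg]
    have := hS.inner_conn_ξ hD s (applyEnd S.φ u) x
    rw [applyEnd_apply, S.φ_sq', map_add, map_neg, map_smul, smul_eq_mul] at this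
    linarith
  have h3 : D.covEnd S.φ s (-t + fmul (metricFun S.g t S.ξ) S.ξ) x
      = -D.covEnd S.φ s t x + S.g.inner x (t x) (S.ξ x) • D.covEnd S.φ s S.ξ x := by
    have e : applyEnd S.φ (-t + fmul (metricFun S.g t S.ξ) S.ξ)
        = -applyEnd S.φ t + fmul (metricFun S.g t S.ξ) (applyEnd S.φ S.ξ) := by
      ext y
      simp
    simp only [D.covEnd_apply, e, map_add, map_neg, ContMDiffSection.coe_add,
      ContMDiffSection.coe_neg, Pi.add_apply, Pi.neg_apply, D.leibniz, map_smul, metricFun_apply,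
      applyEnd_apply, S.φ_ξ]
    module
  simp only [Q, h3, ContMDiffSection.coe_add, ContMDiffSection.coe_neg, Pi.add_apply,
    Pi.neg_apply, map_add, map_neg, map_smul, _root_.add_apply, _root_.neg_apply,
    _root_.smul_apply, smul_eq_mul, fmul_apply, metricFun_apply, h2, S.inner_ξ_ξ] at h1
  linear_combination -h1

/-- Apply `φ` to the formula at `t = ξ`; `φ²` acts as `-1` on `∇_s ξ`, which is orthogonal to `ξ`.
-/
lemma LinearConnection.IsLeviCivita.conn_ξ
    (h : ∀ (s t : Sec n F E) (x : M), D.covEnd S.φ s t x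
      = S.g.inner x (s x) (t x) • S.ξ x - S.g.inner x (t x) (S.ξ x) • s x)
    (s : Sec n F E) (x : M) : D.conn s S.ξ x = -S.φ x (s x) := by
  have h1 := congrArg (S.φ x) (h s S.ξ x)
  rw [D.covEnd_ξ, map_neg, S.φ_sq', hD.inner_conn_ξ_ξ, map_sub, map_smul, map_smul, S.φ_ξ,
    S.inner_ξ_ξ] at h1
  simpa using h1

lemma LinearConnection.IsLeviCivita.isSasakian
    (h : ∀ (s t : Sec n F E) (x : M), D.covEnd S.φ s t x
      = S.g.inner x (s x) (t x) • S.ξ x - S.g.inner x (t x) (S.ξ x) • s x) :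
    S.IsSasakian A := by
  have hΩ : ∀ s t : Sec n F E, A.d S.η s t = S.Ω s t := by
    intro s t
    ext x
    rw [hD.d_η S, hD.conn_ξ h, hD.conn_ξ h]
    simp only [map_neg, _root_.neg_apply, S.inner_φ, AlmostContactRiemannian.Ω]
    rw [S.g.symm x (t x), S.inner_φ]
    ring
  refine ⟨hΩ, fun s t x => ?_⟩
  rw [hΩ, hD.nijenhuis_apply S]
  simp only [h, AlmostContactRiemannian.Ω, applyEnd_apply, map_sub, map_smul, S.φ_ξ, S.inner_φ]
  rw [S.g.symm x (t x) (S.φ x (s x)), S.inner_φ, S.g.symm x (t x) (s x)]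
  module

end Sasakian

end

end AlgebroidGeometry

open AlgebroidGeometry in
theorem theorem4p3 {n m : ℕ}
    {M : Type*} [TopologicalSpace M] [T2Space M] [SecondCountableTopology M]
    [ChartedSpace (EuclideanSpace ℝ (Fin n)) M] [IsManifold (𝓡 n) ∞ M]
    {F : Type*} [NormedAddCommGroup F] [NormedSpace ℝ F] [FiniteDimensional ℝ F]
    (hrank : Module.finrank ℝ F = 2 * m + 1)
    {E : M → Type*} [TopologicalSpace (TotalSpace F E)]
    [∀ x, TopologicalSpace (E x)] [∀ x, AddCommGroup (E x)] [∀ x, Module ℝ (E x)]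
    [∀ x, IsTopologicalAddGroup (E x)] [∀ x, ContinuousSMul ℝ (E x)]
    [FiberBundle F E] [VectorBundle ℝ F E] [ContMDiffVectorBundle ∞ F E (𝓡 n)]
    (A : LieAlgebroid n F E) (S : AlmostContactRiemannian n F E)
    (D : LinearConnection A) (hD : D.IsLeviCivita S.g) :
    S.IsSasakian A ↔
      ∀ (s₁ s₂ : Sec n F E) (x : M),
        D.covEnd S.φ s₁ s₂ x
          = S.g.inner x (s₁ x) (s₂ x) • S.ξ x - (S.η x (s₂ x) : ℝ) • s₁ x := by
  simp only [S.η_eq]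
  refine ⟨fun hS s t x => ?_, fun h => hD.isSasakian h⟩
  -- The defect is itself a smooth section, so the weak identity can be tested against it, with no
  -- need to extend vectors to sections.
  let w : Sec n F E := D.covEnd S.φ s t
    - (fmul (metricFun S.g s t) S.ξ - fmul (metricFun S.g t S.ξ) s)
  refine sub_eq_zero.1 (S.inner_self_eq_zero x (v := w x) ?_)
  have h := hS.inner_covEnd hD s t w x
  have hw : w x = D.covEnd S.φ s t x
    - (S.g.inner x (s x) (t x) • S.ξ x - S.g.inner x (t x) (S.ξ x) • s x) := rfl
  calc S.g.inner x (w x) (w x)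
      = S.g.inner x (D.covEnd S.φ s t x) (w x)
        - (S.g.inner x (s x) (t x) * S.g.inner x (w x) (S.ξ x)
          - S.g.inner x (t x) (S.ξ x) * S.g.inner x (s x) (w x)) := by
        conv_lhs => enter [1]; rw [hw]
        simp only [map_sub, map_smul, _root_.sub_apply, _root_.smul_apply, smul_eq_mul,
          S.g.symm x (S.ξ x) (w x)]
    _ = 0 := by rw [h, sub_self]
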